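/- For a finite set $[n]=\{1,\dots,n\}$ and $A\subseteq[n]$ let $\mathrm{Intersects}_A\colon 2^{[n]}\to\{0,1\}$ be the function with $\mathrm{Intersects}_A(S)=1$ if and only if $A\cap S\neq\emptyset$. In the exact gap version of group testing (EGGT) on $[n]$ with parameters $k$ and $d$, one is given oracle access to $\mathrm{Intersects}_A$ for an unknown $A\subseteq[n]$ with either $|A|=k$ or $|A|=k+d$, and has to decide which is the case. Its randomized query complexity $R_n(k,d)$ is the least $T$ for which there is a randomized algorithm (a probability distribution over deterministic decision trees of depth at most $T$, each vertex of which queries the oracle at one set $S\subseteq[n]$) that for every such $A$ answers correctly with probability at least $2/3$. Theorem. For all $k,d\ge 1$, the randomized query complexity of EGGT with parameters $k$ and $d$ is $\widetilde\Omega\bigl(\min\{k,\,1+(k/d)^2\}\bigr)$, for all sufficiently large $n$. That is, there are absolute constants $c>0$ and $a\in\mathbb N$ such that for all integers $k,d\ge 1$ there is $N=N(k,d)$ such that for all $n\ge N$ $$R_n(k,d)\;\ge\; c\,\frac{g}{\bigl(\ln(2+g)\bigr)^{a}},\qquad\text{where } g=\min\{k,\,1+(k/d)^2\}.$$ -/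

import Mathlib

/-- Deterministic decision trees with Boolean output that make Boolean-valued queries from `Q`.
A vertex `query q t₀ t₁` asks `q` and continues with `t₀` on answer `0` and `t₁` on answer `1`. -/
inductive DecisionTree (Q : Type) : Type
  | leaf (b : Bool) : DecisionTree Q
  | query (q : Q) (t₀ t₁ : DecisionTree Q) : DecisionTree Q

namespace DecisionTree

/-- The output of the tree when every query `q` is answered by `f q`. -/
def eval {Q : Type} (f : Q → Bool) : DecisionTree Q → Bool
  | leaf b => b
  | query q t₀ t₁ => if f q = true then eval f t₁ else eval f t₀

/-- The depth of the tree: the largest number of queries made on a path from the root to a leaf. -/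
def depth {Q : Type} : DecisionTree Q → ℕ
  | leaf _ => 0
  | query _ t₀ t₁ => max (depth t₀) (depth t₁) + 1

end DecisionTree

/-- A randomized query algorithm: a probability distribution over deterministic decision trees. -/
abbrev RandomizedAlgorithm (Q : Type) : Type := PMF (DecisionTree Q)

namespace RandomizedAlgorithm

/-- The algorithm never makes more than `T` queries. -/
def UsesAtMost {Q : Type} (P : RandomizedAlgorithm Q) (T : ℕ) : Prop :=
  ∀ t ∈ P.support, t.depth ≤ T

/-- The probability that the algorithm outputs `b` when it is run on the oracle `f`. -/
noncomputable def outputProb {Q : Type} (P : RandomizedAlgorithm Q) (f : Q → Bool) (b : Bool) :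
    ENNReal :=
  (PMF.map (fun t => DecisionTree.eval f t) P) b

/-- With error probability at most `1/3` on every promised oracle, the algorithm decides whether
the oracle is in `X` (output `0`) or in `Y` (output `1`). -/
def Decides {Q : Type} (P : RandomizedAlgorithm Q) (X Y : Set (Q → Bool)) : Prop :=
  (∀ f ∈ X, 2 / 3 ≤ P.outputProb f false) ∧ (∀ f ∈ Y, 2 / 3 ≤ P.outputProb f true)

end RandomizedAlgorithm

/-- The (bounded-error, worst-case) randomized query complexity of distinguishing the oracles in
`X` from those in `Y`: the least `T` such that some randomized algorithm making at most `T`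
queries decides between `X` and `Y`. -/
noncomputable def randomizedQueryComplexity {Q : Type} (X Y : Set (Q → Bool)) : ℕ :=
  sInf {T : ℕ | ∃ P : RandomizedAlgorithm Q, P.UsesAtMost T ∧ P.Decides X Y}

/-- The oracle `Intersects_A`, whose value at `S` is `1` iff `A ∩ S ≠ ∅`. -/
def intersects {n : ℕ} (A : Finset (Fin n)) (S : Finset (Fin n)) : Bool :=
  decide (A ∩ S).Nonempty

/-- The oracles `Intersects_A` for subsets `A` of an `n`-element set with exactly `s` elements. -/
def intersectsOfCard (n s : ℕ) : Set (Finset (Fin n) → Bool) :=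
  {f | ∃ A : Finset (Fin n), A.card = s ∧ f = intersects A}

/-- The randomized query complexity of the exact gap version of group testing on an `n`-element
set with parameters `k` and `d`: given oracle access to `Intersects_A`, where `|A| = k` or
`|A| = k + d`, decide which is the case. -/
noncomputable def randomizedComplexityEGGT (n k d : ℕ) : ℕ :=
  randomizedQueryComplexity (intersectsOfCard n k) (intersectsOfCard n (k + d))

/-! Let the hidden set `A` be uniform of size `k` or of size `k + d`. Answer a query by scanning its
undecided elements one at a time until one lies in `A`. This only gives away more information, and
each query uncovers at most one new element of `A`. By symmetry the scanning order is irrelevant, so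
`T` queries distinguish the two laws no better than the `T` smallest elements of `A` do
(`prefixAffinity_le_affinity`). As `n → ∞`, with `a = k - T` and `b = k + d - T`, the squared
normalized affinity of these prefixes tends to `∏ (1 - ((b - a) / (a + b + 2 * i)) ^ 2)` over `1 ≤ i
≤ T` (`leadingCoeff_mul_rpow_le`, `one_sub_le_leadingCoeff_sq`). This is close to `1` when `T` is
small compared with `k` and `(k / d) ^ 2`. Average success `s` forces squared affinity at most `4 *
s * (1 - s)`, which is `8 / 9` at `s = 2 / 3`; hence `success_lt` and, by averaging over trees,
`not_decides`. -/

namespace EGGT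

open Finset

/-! ### Affinities of outputs and of prefixes. -/

/-- The number of `m`-subsets `A` of `U` for which the tree `t`, run on the oracle of `A ∪ K`,
outputs `b`. -/
def outputCount {n : ℕ} (t : DecisionTree (Finset (Fin n))) (U K : Finset (Fin n)) (m : ℕ)
    (b : Bool) : ℕ :=
  ((U.powersetCard m).filter fun A => t.eval (intersects (A ∪ K)) = b).card

/-- The unnormalized Bhattacharyya coefficient of the outputs of `t` on random hidden sets
of sizes `m` and `m'`. -/
noncomputable def affinity {n : ℕ} (t : DecisionTree (Finset (Fin n))) (U K : Finset (Fin n))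
    (m m' : ℕ) : ℝ :=
  √(outputCount t U K m false * outputCount t U K m' false) +
    √(outputCount t U K m true * outputCount t U K m' true)

/-- The unnormalized Bhattacharyya coefficient of the laws of the `T` smallest elements of random
subsets of `{1, …, u}` of sizes `a + T` and `b + T`. -/
noncomputable def prefixAffinity (a b : ℕ) : ℕ → ℕ → ℝ
  | 0, u => √(u.choose a * u.choose b)
  | T + 1, u => ∑ y ∈ range u, prefixAffinity a b T y

lemma prefixAffinity_nonneg (a b T u : ℕ) : 0 ≤ prefixAffinity a b T u := by
  induction T generalizing u with
  | zero => exact Real.sqrt_nonneg _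
  | succ T ih => exact sum_nonneg fun y _ => ih y

lemma prefixAffinity_succ_succ (a b T u : ℕ) :
    prefixAffinity a b (T + 1) (u + 1) = prefixAffinity a b (T + 1) u + prefixAffinity a b T u :=
  sum_range_succ _ _

lemma sqrt_mul_add_sqrt_mul_le {p q p' q' : ℝ} (hp : 0 ≤ p) (hq : 0 ≤ q) (hp' : 0 ≤ p')
    (hq' : 0 ≤ q') : √(p * p') + √(q * q') ≤ √((p + q) * (p' + q')) := by
  apply Real.le_sqrt_of_sq_le
  rw [Real.sqrt_mul hp, Real.sqrt_mul hq]
  have h1 := Real.sq_sqrt hp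
  have h2 := Real.sq_sqrt hq
  have h3 := Real.sq_sqrt hp'
  have h4 := Real.sq_sqrt hq'
  calc _ ≤ (√p ^ 2 + √q ^ 2) * (√p' ^ 2 + √q' ^ 2) := by
        nlinarith [sq_nonneg (√p * √q' - √q * √p')]
    _ = _ := by rw [h1, h2, h3, h4]

/-- Forgetting the last revealed element coarsens both laws, which can only raise the affinity. The
base case is Pascal's rule with Cauchy–Schwarz. -/
lemma prefixAffinity_succ_le (a b T u : ℕ) :
    prefixAffinity a b (T + 1) u ≤ prefixAffinity (a + 1) (b + 1) T u := by
  induction T generalizing u with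
  | zero =>
    induction u with
    | zero => simp [prefixAffinity]
    | succ u ih =>
      rw [prefixAffinity_succ_succ]
      refine (add_le_add_left ih _).trans ?_
      simp only [prefixAffinity, Nat.choose_succ_succ, Nat.cast_add]
      refine (sqrt_mul_add_sqrt_mul_le ?_ ?_ ?_ ?_).trans (le_of_eq ?_) <;> try positivity
      congr 1; ring
  | succ T ih => exact sum_le_sum fun y _ => ih y

lemma prefixAffinity_le_sqrt (a b T u : ℕ) :
    prefixAffinity a b T u ≤ √(u.choose (a + T) * u.choose (b + T)) := by
  induction T generalizing a b with
  | zero => exact le_rfl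
  | succ T ih =>
    refine (prefixAffinity_succ_le a b T u).trans ((ih (a + 1) (b + 1)).trans (le_of_eq ?_))
    rw [add_right_comm a, add_right_comm b]; rfl

/-! ### Reduction of decision trees to prefixes. -/

lemma affinity_congr {n : ℕ} {t t' : DecisionTree (Finset (Fin n))} {U K : Finset (Fin n)}
    (h : ∀ A ⊆ U, t.eval (intersects (A ∪ K)) = t'.eval (intersects (A ∪ K))) (m m' : ℕ) :
    affinity t U K m m' = affinity t' U K m m' := by
  have key : ∀ m b, outputCount t U K m b = outputCount t' U K m b := fun m b => by
    unfold outputCount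
    congr 1
    refine filter_congr fun A hA => ?_
    rw [h A (mem_powersetCard.1 hA).1]
  simp only [affinity, key]

lemma outputCount_split {n : ℕ} (t : DecisionTree (Finset (Fin n))) {U K : Finset (Fin n)}
    {x : Fin n} (hx : x ∈ U) (m : ℕ) (b : Bool) :
    outputCount t U K (m + 1) b =
      outputCount t (U.erase x) K (m + 1) b + outputCount t (U.erase x) (insert x K) m b := by
  unfold outputCount
  conv_lhs => rw [← insert_erase hx]
  rw [powersetCard_succ_insert (notMem_erase x U), filter_union, card_union_of_disjoint]
  · congr 1
    rw [filter_image, card_image_of_injOn]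
    · simp [insert_union, union_insert]
    · intro A hA B hB h
      simp only [coe_filter, mem_powersetCard, Set.mem_ofPred_eq] at hA hB
      have hA' : x ∉ A := fun h => notMem_erase x U (hA.1.1 h)
      have hB' : x ∉ B := fun h => notMem_erase x U (hB.1.1 h)
      rw [← erase_insert hA', ← erase_insert hB', h]
  · rw [disjoint_left]
    intro A hA hA'
    simp only [mem_filter, mem_powersetCard, mem_image] at hA hA'
    obtain ⟨⟨B, -, rfl⟩, -⟩ := hA'
    exact notMem_erase x U (hA.1.1 (mem_insert_self x B))

/-- Revealing whether `x` is in the hidden set refines both laws, so by Cauchy–Schwarz the affinity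
can only drop. The set `K` collects the elements known to be hidden, `U` the undecided ones. -/
lemma affinity_split {n : ℕ} (t : DecisionTree (Finset (Fin n))) {U K : Finset (Fin n)}
    {x : Fin n} (hx : x ∈ U) (m m' : ℕ) :
    affinity t (U.erase x) K (m + 1) (m' + 1) + affinity t (U.erase x) (insert x K) m m' ≤
      affinity t U K (m + 1) (m' + 1) := by
  unfold affinity
  simp only [outputCount_split t hx, Nat.cast_add]
  have h (b : Bool) := sqrt_mul_add_sqrt_mul_le
    (Nat.cast_nonneg (α := ℝ) (outputCount t (U.erase x) K (m + 1) b))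
    (Nat.cast_nonneg (α := ℝ) (outputCount t (U.erase x) (insert x K) m b))
    (Nat.cast_nonneg (α := ℝ) (outputCount t (U.erase x) K (m' + 1) b))
    (Nat.cast_nonneg (α := ℝ) (outputCount t (U.erase x) (insert x K) m' b))
  linarith [h true, h false]

lemma affinity_leaf {n : ℕ} (c : Bool) (U K : Finset (Fin n)) (m m' : ℕ) :
    affinity (.leaf c) U K m m' = √(U.card.choose m * U.card.choose m') := by
  cases c <;> simp [affinity, outputCount, DecisionTree.eval, filter_true_of_mem]

theorem prefixAffinity_le_affinity {n : ℕ} (t : DecisionTree (Finset (Fin n))) (T : ℕ)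
    (hT : t.depth ≤ T) (U K : Finset (Fin n)) (a b : ℕ) :
    prefixAffinity a b T U.card ≤ affinity t U K (a + T) (b + T) := by
  induction t generalizing T U K a b with
  | leaf c =>
    rw [affinity_leaf]
    exact prefixAffinity_le_sqrt a b T _
  | query S t₀ t₁ ih₀ ih₁ =>
    obtain ⟨T, rfl⟩ : ∃ T', T = T' + 1 := ⟨T - 1, by simp only [DecisionTree.depth] at hT; omega⟩
    have h₀ : t₀.depth ≤ T := by simp only [DecisionTree.depth] at hT; omega
    have h₁ : t₁.depth ≤ T := by simp only [DecisionTree.depth] at hT; omega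
    have hit : ∀ U K : Finset (Fin n), (S ∩ K).Nonempty → ∀ m m',
        affinity (.query S t₀ t₁) U K m m' = affinity t₁ U K m m' := by
      intro U K hK m m'
      refine affinity_congr (fun A _ => ?_) m m'
      have : ((A ∪ K) ∩ S).Nonempty := by
        obtain ⟨y, hy⟩ := hK
        rw [mem_inter] at hy
        exact ⟨y, mem_inter.2 ⟨mem_union_right _ hy.2, hy.1⟩⟩
      simp [DecisionTree.eval, intersects, this]
    -- Here the answer is known to be `1`: the query is wasted, and the unused revelation is given
    -- up by `prefixAffinity_succ_le`.
    by_cases hK : (S ∩ K).Nonempty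
    · rw [hit U K hK]
      refine (prefixAffinity_succ_le a b T _).trans ?_
      have := ih₁ T h₁ U K (a + 1) (b + 1)
      rwa [add_right_comm a, add_right_comm b] at this
    -- Scan `S ∩ U`: an element outside the hidden set leaves `U`, the first one inside moves to `K`
    -- and forces answer `1`. If `S ∩ U` is exhausted, the answer is `0`.
    induction hu : U.card generalizing U with
    | zero => simpa [prefixAffinity] using by unfold affinity; positivity
    | succ u ihu =>
      by_cases hU : (S ∩ U).Nonempty
      · obtain ⟨x, hx⟩ := hU
        rw [mem_inter] at hx
        have hc : (U.erase x).card = u := by rw [card_erase_of_mem hx.2, hu]; rfl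
        rw [prefixAffinity_succ_succ]
        refine le_trans (add_le_add (ihu _ hc) ?_)
          (affinity_split _ hx.2 (a + T) (b + T))
        rw [hit _ _ ⟨x, mem_inter.2 ⟨hx.1, mem_insert_self x K⟩⟩, ← hc]
        exact ih₁ T h₁ _ _ a b
      · rw [← hu]
        refine (prefixAffinity_succ_le a b T _).trans ?_
        have := ih₀ T h₀ U K (a + 1) (b + 1)
        rw [add_right_comm a, add_right_comm b] at this
        refine this.trans (le_of_eq (affinity_congr (fun A hA => ?_) _ _))
        have : ¬ ((A ∪ K) ∩ S).Nonempty := by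
          rintro ⟨y, hy⟩
          rw [mem_inter, mem_union] at hy
          rcases hy.1 with h | h
          · exact hU ⟨y, mem_inter.2 ⟨hy.2, hA h⟩⟩
          · exact hK ⟨y, mem_inter.2 ⟨hy.2, h⟩⟩
        simp [DecisionTree.eval, intersects, this]

/-! ### Asymptotics of the prefix affinity. -/

/-- The leading coefficient of `prefixAffinity a b T u` as `u → ∞`. -/
noncomputable def leadingCoeff (a b : ℕ) : ℕ → ℝ
  | 0 => 1 / √(a.factorial * b.factorial)
  | T + 1 => leadingCoeff a b T / ((a + b) / 2 + (T + 1))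

lemma leadingCoeff_nonneg (a b T : ℕ) : 0 ≤ leadingCoeff a b T := by
  induction T with
  | zero => unfold leadingCoeff; positivity
  | succ T ih => unfold leadingCoeff; positivity

/-- The power function lies below its tangent lines. -/
lemma rpow_succ_sub_le {h : ℝ} (hh : 0 ≤ h) (z : ℕ) :
    ((z + 1 : ℕ) : ℝ) ^ (h + 1) ≤ (h + 1) * ((z + 1 : ℕ) : ℝ) ^ h + (z : ℝ) ^ (h + 1) := by
  have hz : (0 : ℝ) < (z + 1 : ℕ) := by positivity
  have hB := one_add_mul_self_le_rpow_one_add (s := -1 / ((z + 1 : ℕ) : ℝ)) (p := h + 1)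
    (by rw [le_div_iff₀ hz]; push_cast; linarith [Nat.cast_nonneg (α := ℝ) z]) (by linarith)
  have e : 1 + -1 / ((z + 1 : ℕ) : ℝ) = z / ((z + 1 : ℕ) : ℝ) := by
    field_simp; push_cast; ring
  rw [e, Real.div_rpow (by positivity) hz.le, le_div_iff₀ (by positivity)] at hB
  have e2 : ((z + 1 : ℕ) : ℝ) ^ (h + 1) = ((z + 1 : ℕ) : ℝ) ^ h * (z + 1 : ℕ) := by
    rw [Real.rpow_add hz, Real.rpow_one]
  have e3 : (1 + (h + 1) * (-1 / ((z + 1 : ℕ) : ℝ))) * ((z + 1 : ℕ) : ℝ) ^ (h + 1) =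
      ((z + 1 : ℕ) : ℝ) ^ (h + 1) - (h + 1) * ((z + 1 : ℕ) : ℝ) ^ h := by
    rw [e2]; field_simp; ring
  linarith

/-- Each summation over `u` raises the exponent by one and divides by the new exponent, as
integration does. The shift `c + T` absorbs lower-order terms; the exponent is a half-integer when
`a + b` is odd, hence the real power. -/
lemma leadingCoeff_mul_rpow_le {a b c : ℕ} (ha : a ≤ c) (hb : b ≤ c) (T u : ℕ) :
    leadingCoeff a b T * ((u - (c + T) : ℕ) : ℝ) ^ (((a : ℝ) + b) / 2 + T) ≤
      prefixAffinity a b T u := by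
  induction T generalizing u with
  | zero =>
    have key : ∀ r ≤ c, ((u - c : ℕ) : ℝ) ^ r / r.factorial ≤ u.choose r := by
      intro r hr
      refine le_trans ?_ (Nat.pow_le_choose r u)
      gcongr
      omega
    simp only [leadingCoeff, prefixAffinity, add_zero, Nat.cast_zero]
    rw [one_div_mul_eq_div, div_le_iff₀ (by positivity), ← Real.sqrt_mul (by positivity)]
    apply Real.le_sqrt_of_sq_le
    rw [← Real.rpow_natCast, ← Real.rpow_mul (by positivity)]
    have : ((a : ℝ) + b) / 2 * (2 : ℕ) = ((a + b : ℕ) : ℝ) := by push_cast; ring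
    rw [this, Real.rpow_natCast, pow_add]
    have h1 := key a ha
    have h2 := key b hb
    rw [div_le_iff₀ (by positivity)] at h1 h2
    refine (mul_le_mul h1 h2 (by positivity) (by positivity)).trans (le_of_eq (by ring))
  | succ T ih =>
    have hpos : (0 : ℝ) < ((a : ℝ) + b) / 2 + (T + 1) := by positivity
    induction u with
    | zero =>
      rw [Nat.zero_sub, Nat.cast_zero, Real.zero_rpow (by push_cast; exact hpos.ne'), mul_zero]
      exact prefixAffinity_nonneg _ _ _ _
    | succ u ihu =>
      by_cases hu : u + 1 ≤ c + (T + 1)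
      · rw [Nat.sub_eq_zero_of_le hu, Nat.cast_zero,
          Real.zero_rpow (by push_cast; exact hpos.ne'), mul_zero]
        exact prefixAffinity_nonneg _ _ _ _
      · obtain ⟨z, rfl⟩ : ∃ z, u = z + 1 + (c + T) := ⟨u - (c + T) - 1, by omega⟩
        rw [prefixAffinity_succ_succ]
        refine le_trans ?_ (add_le_add ihu (ih _))
        rw [show z + 1 + (c + T) + 1 - (c + (T + 1)) = z + 1 by omega,
          show z + 1 + (c + T) - (c + (T + 1)) = z by omega,
          show z + 1 + (c + T) - (c + T) = z + 1 by omega]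
        have hs := rpow_succ_sub_le (h := ((a : ℝ) + b) / 2 + T) (by positivity) z
        rw [show ((a : ℝ) + b) / 2 + T + 1 = ((a : ℝ) + b) / 2 + (T + 1 : ℕ) by
          push_cast; ring] at hs
        have hl : leadingCoeff a b T =
            leadingCoeff a b (T + 1) * (((a : ℝ) + b) / 2 + (T + 1 : ℕ)) := by
          rw [leadingCoeff]; push_cast; field_simp
        rw [hl, mul_assoc, ← mul_add]
        refine mul_le_mul_of_nonneg_left ?_ (leadingCoeff_nonneg _ _ _)
        linarith

/-- The right side is the product of the ratios `(a + i) * (b + i) / ((a + b) / 2 + i) ^ 2` for `1 ≤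
i ≤ T`, each at least `1 - ((b - a) / (a + b)) ^ 2`. -/
lemma one_sub_le_leadingCoeff_sq {a b : ℕ} (ha : 1 ≤ a) (T : ℕ) :
    1 - T * (((b : ℝ) - a) / (a + b)) ^ 2 ≤
      leadingCoeff a b T ^ 2 * ((a + T).factorial * (b + T).factorial) := by
  have ha' : (1 : ℝ) ≤ a := by exact_mod_cast ha
  set δ := (((b : ℝ) - a) / (a + b)) ^ 2 with hδ
  have hδ0 : 0 ≤ δ := sq_nonneg _
  induction T with
  | zero =>
    simp only [leadingCoeff, add_zero, div_pow, one_pow]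
    rw [Real.sq_sqrt (by positivity)]
    field_simp
    simp
  | succ T ih =>
    set X := leadingCoeff a b T ^ 2 * (((a + T).factorial : ℝ) * (b + T).factorial)
    have hX : 0 ≤ X := by positivity
    set Y : ℝ := (a + T + 1) * (b + T + 1) / (((a : ℝ) + b) / 2 + (T + 1)) ^ 2 with hY
    have hY0 : 0 ≤ Y := by positivity
    have e : leadingCoeff a b (T + 1) ^ 2 *
        (((a + (T + 1)).factorial : ℝ) * (b + (T + 1)).factorial) = X * Y := by
      rw [leadingCoeff, ← add_assoc a, ← add_assoc b, Nat.factorial_succ, Nat.factorial_succ]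
      push_cast
      rw [div_pow, div_mul_eq_mul_div, ← mul_div_assoc]
      congr 1
      ring
    have hY1 : 1 - δ ≤ Y := by
      have h1 : Y = 1 - ((b : ℝ) - a) ^ 2 / (a + b + 2 * (T + 1)) ^ 2 := by
        rw [hY]; field_simp; ring
      rw [h1, hδ, div_pow]
      have h2 : (a : ℝ) + b ≤ a + b + 2 * (T + 1) := by
        linarith [Nat.cast_nonneg (α := ℝ) T]
      gcongr
    rw [e]
    push_cast
    have hT : (0 : ℝ) ≤ T := Nat.cast_nonneg T
    -- The two lower bounds may be multiplied only when they are nonnegative; otherwise the claimed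
    -- bound is itself nonpositive.
    by_cases h1 : 1 - δ ≤ 0
    · nlinarith [mul_nonneg hX hY0, mul_nonneg hT hδ0]
    · by_cases h2 : 1 - T * δ ≤ 0
      · nlinarith [mul_nonneg hX hY0, mul_nonneg hT hδ0]
      · push Not at h1 h2
        have := mul_le_mul ih hY1 h1.le hX
        nlinarith [mul_nonneg hT (mul_nonneg hδ0 hδ0)]

/-! ### The error of a single tree. -/

lemma outputCount_add {n : ℕ} (t : DecisionTree (Finset (Fin n))) (U K : Finset (Fin n)) (m : ℕ) :
    outputCount t U K m false + outputCount t U K m true = U.card.choose m := by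
  unfold outputCount
  rw [← card_powersetCard, ← card_filter_add_card_filter_not
    (s := U.powersetCard m) (fun A => t.eval (intersects (A ∪ K)) = false)]
  simp

/-- If few queries are made, the normalized affinity stays close to `1`. -/
lemma affinity_sq_gt {n k d T : ℕ} (hk : 1 ≤ k) (hd : 1 ≤ d) (hTk : 2 * T ≤ k)
    (hTd : 18 * (T * d ^ 2) ≤ k ^ 2) (hn : 200 * (k + d) ^ 2 ≤ n)
    (t : DecisionTree (Finset (Fin n))) (ht : t.depth ≤ T) :
    8 / 9 * ((n.choose k : ℝ) * n.choose (k + d)) < affinity t univ ∅ k (k + d) ^ 2 := by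
  obtain ⟨a, rfl⟩ : ∃ a, k = a + T := ⟨k - T, by omega⟩
  have ha : 1 ≤ a := by omega
  have hbT : a + T + d = a + d + T := by ring
  set b := a + d with hb
  rw [hbT] at hn ⊢
  have h0 := (leadingCoeff_mul_rpow_le (c := b) (by omega : a ≤ b) le_rfl T n)
  have h1 := prefixAffinity_le_affinity t T ht univ ∅ a b
  rw [card_univ, Fintype.card_fin] at h1
  have h2 := pow_le_pow_left₀ (by have := leadingCoeff_nonneg a b T; positivity)
    (h0.trans h1) 2
  refine lt_of_lt_of_le ?_ h2
  rw [mul_pow, ← Real.rpow_natCast (_ ^ _), ← Real.rpow_mul (by positivity),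
    show (((a : ℝ) + b) / 2 + T) * (2 : ℕ) = ((a + T + (b + T) : ℕ) : ℝ) by push_cast; ring,
    Real.rpow_natCast]
  have hδ := one_sub_le_leadingCoeff_sq (b := b) ha T
  have hδ' : (17 : ℝ) / 18 ≤ 1 - T * (((b : ℝ) - a) / (a + b)) ^ 2 := by
    have e : (b : ℝ) - a = d := by rw [hb]; push_cast; ring
    have e' : (0 : ℝ) < a + b := by positivity
    rw [e, div_pow, ← mul_div_assoc]
    have : (T : ℝ) * d ^ 2 / (a + b) ^ 2 ≤ 1 / 18 := by
      rw [div_le_div_iff₀ (by positivity) (by norm_num)]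
      -- Since `2 * T ≤ k`, one has `T ≤ a ≤ b`, so the denominator `a + b` is at least `k`.
      have h3 : a + T ≤ a + b := by omega
      have h4 := hTd.trans (Nat.pow_le_pow_left h3 2)
      have : (18 : ℝ) * (T * d ^ 2) ≤ (a + b) ^ 2 := by exact_mod_cast h4
      linarith
    linarith
  have hbn : (b + T) ^ 2 * 200 ≤ n := by rw [mul_comm]; exact hn
  have hbpos : 1 ≤ b + T := by omega
  have hn0 : b + T ≤ n := by nlinarith
  have hnR : (0 : ℝ) < n := by exact_mod_cast (by omega : 0 < n)
  -- Bernoulli's inequality; this is where `n` must be large compared with `(k + d) ^ 2`.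
  have hpow : (49 / 50 : ℝ) * n ^ (a + T + (b + T)) ≤
      ((n - (b + T) : ℕ) : ℝ) ^ (a + T + (b + T)) := by
    rw [← le_div_iff₀ (by positivity), ← div_pow, Nat.cast_sub hn0, sub_div, div_self hnR.ne']
    have hq : (((b + T : ℕ) : ℝ)) / n ≤ 1 := by
      rw [div_le_one hnR]; exact_mod_cast hn0
    have hB := one_add_mul_le_pow (a := -(((b + T : ℕ) : ℝ) / n)) (by linarith)
      (a + T + (b + T))
    rw [← sub_eq_add_neg] at hB
    refine le_trans ?_ hB
    have : ((a + T + (b + T) : ℕ) : ℝ) * (((b + T : ℕ) : ℝ) / n) ≤ 1 / 50 := by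
      rw [← mul_div_assoc, div_le_div_iff₀ hnR (by norm_num)]
      have : (a + T + (b + T)) * (b + T) * 50 ≤ 1 * n := by nlinarith
      exact_mod_cast this
    linarith
  set P : ℝ := ((n - (b + T) : ℕ) : ℝ) ^ (a + T + (b + T))
  set F : ℝ := ((a + T).factorial : ℝ) * (b + T).factorial with hF
  have hFpos : 0 < F := by positivity
  have hC : (n.choose (a + T) : ℝ) * n.choose (b + T) ≤ n ^ (a + T + (b + T)) / F := by
    rw [pow_add, hF, mul_div_mul_comm]
    exact mul_le_mul (Nat.choose_le_pow_div _ _) (Nat.choose_le_pow_div _ _) (by positivity)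
      (by positivity)
  have hnp : (0 : ℝ) < n ^ (a + T + (b + T)) := by positivity
  refine (mul_le_mul_of_nonneg_left hC (by norm_num)).trans_lt ?_
  rw [← mul_div_assoc, div_lt_iff₀ hFpos]
  have h5 := mul_le_mul (hδ'.trans hδ) hpow (by positivity) (by positivity)
  -- Numerically, `8 / 9 < 17 / 18 * (49 / 50)`.
  calc _ < 17 / 18 * (49 / 50 * (n : ℝ) ^ (a + T + (b + T))) := by linarith
    _ ≤ _ := h5
    _ = _ := by ring

/-- A tree of small depth errs, on average over the two sizes of hidden sets, with probability
more than `1 / 3`. -/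
lemma success_lt {n k d T : ℕ} (hk : 1 ≤ k) (hd : 1 ≤ d) (hTk : 2 * T ≤ k)
    (hTd : 18 * (T * d ^ 2) ≤ k ^ 2) (hn : 200 * (k + d) ^ 2 ≤ n)
    (t : DecisionTree (Finset (Fin n))) (ht : t.depth ≤ T) :
    3 * (n.choose (k + d) * outputCount t univ ∅ k false +
      n.choose k * outputCount t univ ∅ (k + d) true) + 1 ≤
      4 * (n.choose k * n.choose (k + d)) := by
  have hα := affinity_sq_gt hk hd hTk hTd hn t ht
  have hC := outputCount_add t univ ∅ k
  have hC' := outputCount_add t univ ∅ (k + d)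
  rw [card_univ, Fintype.card_fin] at hC hC'
  unfold affinity at hα
  rw [← hC, ← hC'] at hα ⊢
  generalize outputCount t univ ∅ k false = p at *
  generalize outputCount t univ ∅ k true = q at *
  generalize outputCount t univ ∅ (k + d) false = p' at *
  generalize outputCount t univ ∅ (k + d) true = q' at *
  clear hC hC' hn
  rw [Nat.succ_le_iff]
  suffices h : (3 : ℝ) * ((p' + q') * p + (p + q) * q') < 4 * ((p + q) * (p' + q')) by
    exact_mod_cast h
  push_cast at hα
  have hp := Nat.cast_nonneg (α := ℝ) p
  have hq := Nat.cast_nonneg (α := ℝ) q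
  have hp' := Nat.cast_nonneg (α := ℝ) p'
  have hq' := Nat.cast_nonneg (α := ℝ) q'
  generalize (p : ℝ) = p at *
  generalize (q : ℝ) = q at *
  generalize (p' : ℝ) = p' at *
  generalize (q' : ℝ) = q' at *
  set C := p + q with hC
  set C' := p' + q' with hC'
  -- Cauchy–Schwarz, pairing each success count with a failure count: the right side is total
  -- success times total failure, and these two sum to `2 * (C * C')`.
  have hCS : (√(p * p') + √(q * q')) ^ 2 * (C * C') ≤ (p * C' + q' * C) * (q * C' + p' * C) := by
    have h := sqrt_mul_add_sqrt_mul_le (p := p * C') (q := q' * C) (p' := p' * C) (q' := q * C')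
      (by positivity) (by positivity) (by positivity) (by positivity)
    have e1 : √(p * C' * (p' * C)) = √(p * p') * √(C * C') := by
      rw [← Real.sqrt_mul (by positivity)]; congr 1; ring
    have e2 : √(q' * C * (q * C')) = √(q * q') * √(C * C') := by
      rw [← Real.sqrt_mul (by positivity)]; congr 1; ring
    rw [e1, e2, ← add_mul] at h
    have h2 := pow_le_pow_left₀ (by positivity) h 2
    rw [mul_pow, Real.sq_sqrt (by positivity), Real.sq_sqrt (by positivity)] at h2
    linarith
  have hCC : 0 < C * C' := by
    have h0 : 0 ≤ C * C' := by positivity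
    refine lt_of_le_of_ne h0 fun h => ?_
    have h3 := mul_nonneg hp hp'
    have h4 := mul_nonneg hp hq'
    have h5 := mul_nonneg hq hp'
    have h6 := mul_nonneg hq hq'
    have h1 : p * p' = 0 := by nlinarith
    have h2 : q * q' = 0 := by nlinarith
    rw [h1, h2, ← h] at hα
    simp at hα
  by_contra! hcon
  have hsum : (p * C' + q' * C) + (q * C' + p' * C) = 2 * (C * C') := by
    rw [hC, hC']; ring
  have h3 := mul_lt_mul_of_pos_right hα hCC
  nlinarith

/-! ### Averaging over the random tree. -/

/-- Averaging over hidden sets: the success counts of a single tree sum up to those of the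
randomized algorithm. -/
lemma le_tsum_outputCount {n s : ℕ} (P : RandomizedAlgorithm (Finset (Fin n))) (b : Bool)
    (h : ∀ f ∈ intersectsOfCard n s, 2 / 3 ≤ P.outputProb f b) :
    (n.choose s : ENNReal) * 2 ≤ 3 * ∑' t, P t * (outputCount t univ ∅ s b : ENNReal) := by
  have e : ∑' t, P t * (outputCount t univ ∅ s b : ENNReal) =
      ∑ A ∈ (univ : Finset (Fin n)).powersetCard s, P.outputProb (intersects A) b := by
    simp only [RandomizedAlgorithm.outputProb, PMF.map_apply]
    rw [← Summable.tsum_finsetSum fun _ _ => ENNReal.summable]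
    refine tsum_congr fun t => ?_
    simp only [outputCount, union_empty, card_filter, Nat.cast_sum, mul_sum]
    refine sum_congr rfl fun A _ => ?_
    by_cases hA : t.eval (intersects A) = b
    · simp [hA]
    · simp [hA, Ne.symm hA]
  rw [e]
  calc (n.choose s : ENNReal) * 2
      = 3 * ∑ A ∈ (univ : Finset (Fin n)).powersetCard s, (2 / 3 : ENNReal) := by
        rw [sum_const, card_powersetCard, card_univ, Fintype.card_fin, nsmul_eq_mul,
          mul_left_comm, ENNReal.mul_div_cancel (by norm_num) (by norm_num)]
    _ ≤ _ := by
        gcongr with A hA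
        exact h _ ⟨A, (mem_powersetCard.1 hA).2, rfl⟩

theorem not_decides {n k d T : ℕ} (hk : 1 ≤ k) (hd : 1 ≤ d) (hTk : 2 * T ≤ k)
    (hTd : 18 * (T * d ^ 2) ≤ k ^ 2) (hn : 200 * (k + d) ^ 2 ≤ n)
    (P : RandomizedAlgorithm (Finset (Fin n))) (hP : P.UsesAtMost T) :
    ¬ P.Decides (intersectsOfCard n k) (intersectsOfCard n (k + d)) := by
  rintro ⟨h₀, h₁⟩
  have g₀ := le_tsum_outputCount P false h₀
  have g₁ := le_tsum_outputCount P true h₁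
  set C : ENNReal := (n.choose k : ENNReal)
  set C' : ENNReal := (n.choose (k + d) : ENNReal)
  set x : DecisionTree (Finset (Fin n)) → ENNReal :=
    fun t => (outputCount t univ ∅ k false : ENNReal)
  set y : DecisionTree (Finset (Fin n)) → ENNReal :=
    fun t => (outputCount t univ ∅ (k + d) true : ENNReal)
  -- The strict inequality between integers is kept as a `+ 1`, which survives averaging because the
  -- weights sum to `1`.
  have hle : ∑' t, P t * (3 * (C' * x t + C * y t) + 1) ≤ 4 * (C * C') := by
    calc _ ≤ ∑' t, P t * (4 * (C * C')) := by
          refine ENNReal.tsum_le_tsum fun t => ?_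
          by_cases ht : t ∈ P.support
          · gcongr
            have := success_lt hk hd hTk hTd hn t (hP t ht)
            simp only [C, C', x, y]
            exact_mod_cast this
          · rw [(PMF.apply_eq_zero_iff P t).2 ht, zero_mul, zero_mul]
      _ = _ := by rw [ENNReal.tsum_mul_right, P.tsum_coe, one_mul]
  have heq : ∑' t, P t * (3 * (C' * x t + C * y t) + 1) =
      C' * (3 * ∑' t, P t * x t) + C * (3 * ∑' t, P t * y t) + 1 := by
    conv_rhs => rw [← P.tsum_coe]
    simp only [← ENNReal.tsum_mul_left, ← ENNReal.tsum_add]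
    refine tsum_congr fun t => ?_
    ring
  rw [heq] at hle
  have hge : 4 * (C * C') + 1 ≤ C' * (3 * ∑' t, P t * x t) + C * (3 * ∑' t, P t * y t) + 1 := by
    calc _ = C' * (C * 2) + C * (C' * 2) + 1 := by ring
      _ ≤ _ := by gcongr
  have hcon := hge.trans hle
  simp only [C, C'] at hcon
  norm_cast at hcon
  omega

/-! ### Finiteness of the complexity, and the conclusion. -/

/-- Every Boolean function of the oracle is computed by a decision tree. -/
lemma exists_tree {Q : Type} [Fintype Q] [DecidableEq Q] (F : (Q → Bool) → Bool) :
    ∃ t : DecisionTree Q, ∀ f, t.eval f = F f := by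
  suffices h : ∀ (s : Finset Q) (F : (Q → Bool) → Bool),
      (∀ f g : Q → Bool, (∀ q ∈ s, f q = g q) → F f = F g) →
        ∃ t : DecisionTree Q, ∀ f, t.eval f = F f from
    h univ F fun f g hfg => congrArg F (funext fun q => hfg q (mem_univ q))
  intro s
  induction s using Finset.induction_on with
  | empty =>
    intro F hF
    exact ⟨.leaf (F fun _ => false), fun f => hF _ _ (by simp)⟩
  | insert q s hq ih =>
    intro F hF
    have key : ∀ c : Bool, ∃ t : DecisionTree Q, ∀ f, t.eval f = F (Function.update f q c) := by
      refine fun c => ih _ fun f g hfg => hF _ _ fun r hr => ?_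
      by_cases hrq : r = q
      · simp [hrq]
      · simpa [hrq] using hfg r (mem_of_mem_insert_of_ne hr hrq)
    obtain ⟨t₀, h₀⟩ := key false
    obtain ⟨t₁, h₁⟩ := key true
    refine ⟨.query q t₀ t₁, fun f => ?_⟩
    by_cases hf : f q = true
    · simp only [DecisionTree.eval, hf, if_true, h₁]
      rw [← hf, Function.update_eq_self]
    · rw [DecisionTree.eval, if_neg hf, h₀, ← Bool.eq_false_of_not_eq_true hf,
        Function.update_eq_self]

lemma intersects_injective (n : ℕ) :
    Function.Injective (intersects : Finset (Fin n) → Finset (Fin n) → Bool) := by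
  intro A B h
  ext x
  have key : ∀ A : Finset (Fin n), (A ∩ {x}).Nonempty ↔ x ∈ A := fun A => by
    simp [Finset.Nonempty]
  simpa [intersects, key] using congrFun h {x}

/-- Ensures that the infimum defining the complexity is attained, rather than being the default
value `sInf ∅ = 0`. -/
lemma exists_algorithm (n k d : ℕ) (hd : 1 ≤ d) :
    ∃ T, ∃ P : RandomizedAlgorithm (Finset (Fin n)), P.UsesAtMost T ∧
      P.Decides (intersectsOfCard n k) (intersectsOfCard n (k + d)) := by
  classical
  obtain ⟨t, ht⟩ := exists_tree (Q := Finset (Fin n))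
    fun f => decide (f ∈ intersectsOfCard n (k + d))
  have h1 : (2 / 3 : ENNReal) ≤ 1 := ENNReal.div_le_of_le_mul (by norm_num)
  refine ⟨t.depth, PMF.pure t, fun t' ht' => ?_, fun f hf => ?_, fun f hf => ?_⟩
  · rw [PMF.support_pure, Set.mem_singleton_iff] at ht'
    rw [ht']
  · have : f ∉ intersectsOfCard n (k + d) := by
      rintro ⟨B, hB, rfl⟩
      obtain ⟨A, hA, hAB⟩ := hf
      have := intersects_injective n hAB
      subst this
      omega
    simpa [RandomizedAlgorithm.outputProb, PMF.pure_map, ht, this] using h1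
  · simpa [RandomizedAlgorithm.outputProb, PMF.pure_map, ht, hf] using h1

end EGGT

theorem mainTheorem9 :
    ∃ c : ℝ, 0 < c ∧ ∃ a : ℕ, ∀ k d : ℕ, 1 ≤ k → 1 ≤ d → ∃ N : ℕ, ∀ n : ℕ, N ≤ n →
      c * min (k : ℝ) (1 + ((k : ℝ) / (d : ℝ)) ^ 2)
          / Real.log (2 + min (k : ℝ) (1 + ((k : ℝ) / (d : ℝ)) ^ 2)) ^ a
        ≤ (randomizedComplexityEGGT n k d : ℝ) := by
  -- No logarithmic factor is lost, so the exponent is `0`. The constant is not tight: the cases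
  -- below give `k ≤ 2 * T` or `1 + (k / d) ^ 2 ≤ 1 + 18 * T ≤ 19 * T`.
  refine ⟨1 / 36, by norm_num, 0, fun k d hk hd => ⟨200 * (k + d) ^ 2, fun n hn => ?_⟩⟩
  rw [pow_zero, div_one]
  obtain ⟨P, hP, hdec⟩ : randomizedComplexityEGGT n k d ∈ _ :=
    Nat.sInf_mem (EGGT.exists_algorithm n k d hd)
  set T := randomizedComplexityEGGT n k d
  have hd0 : (0 : ℝ) < d := by exact_mod_cast hd
  -- This accounts for the summand `1` in `1 + (k / d) ^ 2`, which matters when `d` is large.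
  have hT : 1 ≤ T := by
    by_contra! h
    have h0 : T = 0 := by omega
    exact EGGT.not_decides hk hd (by omega) (by simp [h0]) hn P hP hdec
  have hT' : (1 : ℝ) ≤ T := by exact_mod_cast hT
  by_cases hTk : 2 * T ≤ k
  · have hTd : k ^ 2 < 18 * (T * d ^ 2) := by
      by_contra! h
      exact EGGT.not_decides hk hd hTk h hn P hP hdec
    have h : (k : ℝ) ^ 2 < 18 * (T * d ^ 2) := by exact_mod_cast hTd
    have h2 : ((k : ℝ) / d) ^ 2 ≤ 18 * T := by
      rw [div_pow, div_le_iff₀ (by positivity)]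
      linarith
    have := min_le_right (k : ℝ) (1 + ((k : ℝ) / d) ^ 2)
    linarith
  · have h : (k : ℝ) ≤ 2 * T := by exact_mod_cast (by omega : k ≤ 2 * T)
    have := min_le_left (k : ℝ) (1 + ((k : ℝ) / d) ^ 2)
    linarith
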